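/- Let $d\ge 1$ and let $\{A_n\}_{n\ge 0}$, $\{B_n\}_{n\ge 0}$ be invertible complex $d\times d$ matrices that are simultaneously unitarily diagonalizable: there are a unitary matrix $Q$ and scalars $a_n^{(q)},b_n^{(q)}$ ($n\ge 0$, $1\le q\le d$) with $$A_n=Q^*\,\mathrm{diag}(a_n^{(1)},\dots,a_n^{(d)})\,Q,\qquad B_n=Q^*\,\mathrm{diag}(b_n^{(1)},\dots,b_n^{(d)})\,Q\qquad(n\ge 0).$$ Assume that the series $$K(z,w)=\sum_{n=0}^{\infty}(A_n+B_nz)(A_n^*+B_n^*\overline w)\,z^n\overline w^{\,n}$$ converges (absolutely) for all $z,w$ in the open unit disc $\mathbb D$, and let $\mathcal H_{\mathcal A,\mathcal B}$ be the reproducing kernel Hilbert space of $\mathbb C^d$-valued functions on $\mathbb D$ with the matrix valued kernel $K$. Suppose that for each $1\le q\le d$ $$\sup_n\left|\frac{a^{(q)}_{n+1}}{a^{(q)}_n}\right|<\infty\qquad\text{and}\qquad\limsup_{n\to\infty}\left|\frac{b^{(q)}_n}{a^{(q)}_{n+1}}\right|<1 .$$ Then every $f\in\mathcal H_{\mathcal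 A,\mathcal B}$ has a power series expansion $f(z)=\sum_{n\ge0}c_nz^n$ on $\mathbb D$ with $c_n\in\mathbb C^d$, the backward shift $(Bf)(z)=\sum_{n\ge0}c_{n+1}z^n$ is a bounded linear operator on $\mathcal H_{\mathcal A,\mathcal B}$, and the following hold. 1. $B$ is hypercyclic (some $f$ has a dense orbit $\{f,Bf,B^2f,\dots\}$) if and only if $\displaystyle\sup_n\Big(\min_{1\le q\le d}|a_n^{(q)}|\Big)=\infty$. 2. $B$ is topologically mixing (for all non-empty open $U,V\subseteq\mathcal H_{\mathcal A,\mathcal B}$ there is $N$ with $B^n(U)\cap V\ne\emptyset$ for all $n\ge N$) if and only if $\displaystyle\lim_{n\to\infty}|a_n^{(q)}|=\infty$ for all $q=1,\dots,d$. 3. $B$ is chaotic (hypercyclic with a dense set of periodic vectors, i.e. of vectors $f$ with $B^pf=f$ for some $p\ge1$) if and only if $\displaystyle\sum_{n=0}^{\infty}|a_n^{(q)}|^{-2}<\infty$ for all $q=1,\dots,d$. -/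

import Mathlib

open scoped Complex.UnitDisc ComplexConjugate Matrix Topology

noncomputable section

namespace TridiagonalShift

/-! ### Linear dynamics of a bounded operator -/

section Dynamics

variable {X : Type*} [NormedAddCommGroup X] [NormedSpace ℂ X]

/-- `T` is hypercyclic: some vector has a dense orbit `{x, T x, T² x, …}`. -/
def IsHypercyclic (T : X →L[ℂ] X) : Prop :=
  ∃ x : X, Dense (Set.range fun n : ℕ => (⇑T)^[n] x)

/-- `T` is topologically mixing: for all non-empty open `U`, `V` one has `Tⁿ(U) ∩ V ≠ ∅` for all
sufficiently large `n`. -/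
def IsMixing (T : X →L[ℂ] X) : Prop :=
  ∀ U V : Set X, IsOpen U → IsOpen V → U.Nonempty → V.Nonempty →
    ∃ N : ℕ, ∀ n : ℕ, N ≤ n → ((⇑T)^[n] '' U ∩ V).Nonempty

/-- `T` is chaotic: it is hypercyclic and its periodic vectors (those `y` with `Tᵖ y = y` for some
`p ≥ 1`) are dense. -/
def IsChaotic (T : X →L[ℂ] X) : Prop :=
  IsHypercyclic T ∧ Dense (Function.periodicPts ⇑T)

end Dynamics

/-! ### The matrix valued tridiagonal kernel -/

section Kernel

variable {d : ℕ}

/-- The `n`-th summand `(A_n + B_n z)(A_n^* + B_n^* w̄) zⁿ w̄ⁿ` of the kernel. -/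
def kernelTerm (A B : ℕ → Matrix (Fin d) (Fin d) ℂ) (z w : 𝔻) (n : ℕ) :
    Matrix (Fin d) (Fin d) ℂ :=
  ((z : ℂ) ^ n * conj (w : ℂ) ^ n) •
    ((A n + (z : ℂ) • B n) * ((A n)ᴴ + conj (w : ℂ) • (B n)ᴴ))

/-- The kernel `K(z, w) = ∑ₙ (A_n + B_n z)(A_n^* + B_n^* w̄) zⁿ w̄ⁿ` on the unit disc; the `d × d`
matrix `K(z, w)` is regarded as an operator on the Euclidean space `ℂᵈ`. It is meaningful when the
series converges for all `z, w ∈ 𝔻`. -/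
def tridiagonalKernel (A B : ℕ → Matrix (Fin d) (Fin d) ℂ) :
    Matrix 𝔻 𝔻 (EuclideanSpace ℂ (Fin d) →L[ℂ] EuclideanSpace ℂ (Fin d)) :=
  Matrix.of fun z w => Matrix.toEuclideanCLM (n := Fin d) (𝕜 := ℂ) (∑' n, kernelTerm A B z w n)

/-- If the series converges on the disc, `K` is positive semidefinite, i.e. a kernel function. -/
theorem tridiagonalKernel_posSemidef (A B : ℕ → Matrix (Fin d) (Fin d) ℂ)
    (hconv : ∀ z w : 𝔻, Summable (kernelTerm A B z w)) :
    (tridiagonalKernel A B).PosSemidef := by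
  have hs : ∀ z w, HasSum (kernelTerm A B z w) (∑' n, kernelTerm A B z w n) :=
    fun z w => (hconv z w).hasSum
  have htfae := (RKHS.posSemidef_tfae (K := tridiagonalKernel A B)).out 0 2
  refine htfae.mpr ⟨?_, fun vv => ?_⟩
  · ext1 z w
    simp only [Matrix.conjTranspose_apply, tridiagonalKernel, Matrix.of_apply]
    rw [← map_star]
    congr 1
    rw [Matrix.star_eq_conjTranspose, Matrix.conjTranspose_tsum]
    congr 1
    ext1 n
    simp [kernelTerm, Matrix.conjTranspose_smul, Matrix.conjTranspose_mul, mul_comm]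
  · have key : ∀ x x' : 𝔻, ∀ w w' : EuclideanSpace ℂ (Fin d),
        HasSum (fun n => inner ℂ (Matrix.toEuclideanCLM (n := Fin d) (𝕜 := ℂ)
          (kernelTerm A B x' x n) w) w') (inner ℂ (tridiagonalKernel A B x' x w) w') := by
      intro x x' w w'
      let L : Matrix (Fin d) (Fin d) ℂ →ₗ[ℂ] ℂ :=
        { toFun := fun M => inner ℂ w' (Matrix.toEuclideanCLM (n := Fin d) (𝕜 := ℂ) M w)
          map_add' := by intro M N; simp
          map_smul' := by intro c M; simp }
      have h1 := (hs x' x).map L (LinearMap.continuous_of_finiteDimensional L)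
      have h2 := h1.star
      simpa [L, Function.comp_def, tridiagonalKernel] using h2
    have hsum : HasSum (fun n => ∑ x ∈ vv.support, ∑ x' ∈ vv.support,
        inner ℂ (Matrix.toEuclideanCLM (n := Fin d) (𝕜 := ℂ)
          (kernelTerm A B x' x n) (vv x)) (vv x'))
        (∑ x ∈ vv.support, ∑ x' ∈ vv.support,
          inner ℂ (tridiagonalKernel A B x' x (vv x)) (vv x')) :=
      hasSum_sum fun x _ => hasSum_sum fun x' _ => key _ _ _ _
    have hre := (Complex.hasSum_re hsum)
    refine hre.nonneg fun n => ?_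
    let F : 𝔻 → Matrix (Fin d) (Fin d) ℂ := fun z => ((z:ℂ)^n) • (A n + (z:ℂ) • B n)
    have hF : ∀ z w, kernelTerm A B z w n = F z * star (F w) := by
      intro z w
      have e : star (F w) = (conj (w : ℂ) ^ n) • ((A n)ᴴ + conj (w : ℂ) • (B n)ᴴ) := by
        simp only [F, Matrix.star_eq_conjTranspose, Matrix.conjTranspose_smul,
          Matrix.conjTranspose_add, star_pow, RCLike.star_def]
      rw [e, kernelTerm, Matrix.smul_mul, Matrix.mul_smul, smul_smul]
    have : (∑ x ∈ vv.support, ∑ x' ∈ vv.support,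
        inner ℂ (Matrix.toEuclideanCLM (n := Fin d) (𝕜 := ℂ)
          (kernelTerm A B x' x n) (vv x)) (vv x')) =
        inner ℂ (∑ x ∈ vv.support, Matrix.toEuclideanCLM (n := Fin d) (𝕜 := ℂ) (star (F x)) (vv x))
         (∑ x ∈ vv.support, Matrix.toEuclideanCLM (n := Fin d) (𝕜 := ℂ) (star (F x)) (vv x)) := by
      rw [sum_inner]
      refine Finset.sum_congr rfl fun x _ => ?_
      rw [inner_sum]
      refine Finset.sum_congr rfl fun x' _ => ?_
      rw [hF, map_mul, map_star _ (F x'), ContinuousLinearMap.star_eq_adjoint,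
        ContinuousLinearMap.adjoint_inner_right]
      rfl
    rw [this]
    exact inner_self_nonneg (𝕜 := ℂ)

/-- Hence the (unique) reproducing kernel Hilbert space with kernel `K` exists. -/
theorem exists_rkhs (A B : ℕ → Matrix (Fin d) (Fin d) ℂ)
    (hconv : ∀ z w : 𝔻, Summable (kernelTerm A B z w)) :
    ∃ (H : Type) (_ : NormedAddCommGroup H) (_ : InnerProductSpace ℂ H) (_ : CompleteSpace H)
      (_ : RKHS ℂ H 𝔻 (EuclideanSpace ℂ (Fin d))),
      RKHS.kernel H = tridiagonalKernel A B := by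
  have : Fact (tridiagonalKernel A B).PosSemidef := ⟨tridiagonalKernel_posSemidef A B hconv⟩
  exact ⟨RKHS.OfKernel (tridiagonalKernel A B), inferInstance, inferInstance, inferInstance,
    inferInstance, RKHS.OfKernel.kernel_ofKernel⟩

end Kernel

/-! ### The backward shift -/

/-- `T` is the (coefficient) backward shift on a reproducing kernel Hilbert space `H` of
`ℂᵈ`-valued functions on the disc: every `f ∈ H` has a power series expansion
`f(z) = ∑ₙ zⁿ cₙ` on `𝔻`, and `(T f)(z) = ∑ₙ zⁿ cₙ₊₁` on `𝔻`. -/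
def IsBackwardShift {d : ℕ} {H : Type*} [NormedAddCommGroup H] [InnerProductSpace ℂ H]
    [RKHS ℂ H 𝔻 (EuclideanSpace ℂ (Fin d))] (T : H →L[ℂ] H) : Prop :=
  ∀ f : H, ∃ c : ℕ → EuclideanSpace ℂ (Fin d),
    (∀ z : 𝔻, HasSum (fun n => (z : ℂ) ^ n • c n) (f z)) ∧
    (∀ z : 𝔻, HasSum (fun n => (z : ℂ) ^ n • c (n + 1)) (T f z))

end TridiagonalShift

end

/-! The term `B_n` is a harmless perturbation. In `ℓ²(ℕ × Fin d)` let `m_{z,q}` have entries `conj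
(zⁿ a_n^{(q)})` in row `q` and zeros elsewhere, and let `V` be the weighted backward shift with
weights `conj (b_n^{(q)} / a_{n+1}^{(q)})`. Then `k_{z,q} = (1 + V) m_{z,q}` has entries `conj (zⁿ
(a_n^{(q)} + z b_n^{(q)}))`, and the Gram matrix of these vectors, conjugated by `Q`, is the kernel
`K`. Hence `H` is unitarily equivalent to `ℓ²` (`exists_unitary_of_kernel_eq`).

The limsup hypothesis makes the norms of the powers of `V` tend to zero, so `1 + V` is invertible
(`isUnit_one_add_shift`). Moving its adjoint across the inner product gives an isomorphism `ℓ² ≃ H`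
sending `y` to the function with coefficients `c_n = Q* (a_n^{(q)} y_{n,q})_q`
(`exists_coefficient_model`). It carries the backward shift to `S y (n, q) = (a_{n+1}^{(q)} /
a_n^{(q)}) y (n+1, q)`, which is bounded by the ratio hypothesis.

Since the weights telescope, `S^k` just moves the sequence `a_n y_n` by `k` places. Finitely
supported vectors are killed by high powers, and their preimages under `S^k` are small when the
relevant `a_{n+k}` are large. This yields transitivity and mixing. Periodic vectors are those with
`a_n y_n` periodic in `n`, and such a `y` lies in `ℓ²` when `∑ |a_n|⁻²` converges. Each property
passes through the conjugacy. -/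

namespace TridiagonalShift

/-! ### Transitivity and invariance of the dynamics under conjugacy. -/

section Dynamics

variable {X Y : Type*} [NormedAddCommGroup X] [NormedSpace ℂ X]
  [NormedAddCommGroup Y] [NormedSpace ℂ Y]

/-- Birkhoff's transitivity theorem: a topologically transitive operator on a separable Banach
space is hypercyclic. -/
theorem isHypercyclic_of_transitive [CompleteSpace X] [SecondCountableTopology X] {T : X →L[ℂ] X}
    (h : ∀ U V : Set X, IsOpen U → IsOpen V → U.Nonempty → V.Nonempty →
      ∃ n : ℕ, ((⇑T)^[n] '' U ∩ V).Nonempty) : IsHypercyclic T := by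
  obtain ⟨b, hbc, hbe, hb⟩ := TopologicalSpace.exists_countable_basis X
  have hopen : ∀ s ∈ b, IsOpen (⋃ n : ℕ, (⇑T)^[n] ⁻¹' s) := fun s hs =>
    isOpen_iUnion fun n => (hb.isOpen hs).preimage (T.continuous.iterate n)
  have hdense : ∀ s ∈ b, Dense (⋃ n : ℕ, (⇑T)^[n] ⁻¹' s) := by
    intro s hs
    rw [dense_iff_inter_open]
    intro U hU hUne
    have hsne : s.Nonempty := Set.nonempty_iff_ne_empty.2 fun h0 => hbe (h0 ▸ hs)
    obtain ⟨n, y, ⟨x, hx, rfl⟩, hy⟩ := h U s hU (hb.isOpen hs) hUne hsne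
    exact ⟨x, hx, Set.mem_iUnion.2 ⟨n, hy⟩⟩
  obtain ⟨x, hx⟩ := (dense_biInter_of_isOpen hopen hbc hdense).nonempty
  refine ⟨x, hb.dense_iff.2 fun s hs _ => ?_⟩
  obtain ⟨n, hn⟩ := Set.mem_iUnion.1 (Set.mem_iInter₂.1 hx s hs)
  exact ⟨_, hn, n, rfl⟩

variable {T : X →L[ℂ] X} {S : Y →L[ℂ] Y} (Φ : X ≃L[ℂ] Y)

theorem IsHypercyclic.of_semiconj (h : Function.Semiconj Φ T S) (hT : IsHypercyclic T) :
    IsHypercyclic S := by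
  obtain ⟨x, hx⟩ := hT
  refine ⟨Φ x, (Φ.surjective.denseRange.dense_image Φ.continuous hx).mono ?_⟩
  rintro _ ⟨_, ⟨n, rfl⟩, rfl⟩
  exact ⟨n, ((h.iterate_right n).eq x).symm⟩

theorem IsMixing.of_semiconj (h : Function.Semiconj Φ T S) (hT : IsMixing T) : IsMixing S := by
  intro U V hU hV hUne hVne
  obtain ⟨N, hN⟩ := hT (Φ ⁻¹' U) (Φ ⁻¹' V) (hU.preimage Φ.continuous) (hV.preimage Φ.continuous)
    (hUne.preimage Φ.surjective) (hVne.preimage Φ.surjective)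
  refine ⟨N, fun n hn => ?_⟩
  obtain ⟨_, ⟨x, hx, rfl⟩, hy⟩ := hN n hn
  exact ⟨S^[n] (Φ x), ⟨Φ x, hx, rfl⟩, by rw [← (h.iterate_right n).eq x]; exact hy⟩

theorem IsChaotic.of_semiconj (h : Function.Semiconj Φ T S) (hT : IsChaotic T) : IsChaotic S := by
  refine ⟨hT.1.of_semiconj Φ h,
    (Φ.surjective.denseRange.dense_image Φ.continuous hT.2).mono ?_⟩
  rintro _ ⟨x, ⟨p, hp, hx⟩, rfl⟩
  exact ⟨p, hp, hx.map h⟩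

end Dynamics

/-! ### Unitary models of a reproducing kernel Hilbert space. -/

section Reproducing

variable {𝕜 H X V E : Type*} [RCLike 𝕜] [NormedAddCommGroup V] [InnerProductSpace 𝕜 V]
  [CompleteSpace V] [NormedAddCommGroup H] [InnerProductSpace 𝕜 H] [CompleteSpace H]
  [NormedAddCommGroup E] [InnerProductSpace 𝕜 E] [CompleteSpace E] [RKHS 𝕜 H X V]

/-- A Hilbert space `E` with a jointly injective family of bounded operators `Λ x : E → V` is
unitarily equivalent to the reproducing kernel Hilbert space with kernel `Λ x ∘ (Λ y)†`. -/
theorem exists_unitary_of_kernel_eq (Λ : X → E →L[𝕜] V)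
    (hker : ∀ x y, RKHS.kernel H x y = Λ x ∘L (Λ y).adjoint)
    (hinj : ∀ e : E, (∀ x, Λ x e = 0) → e = 0) :
    ∃ U : E ≃ₗᵢ[𝕜] H, ∀ e x, U e x = Λ x e := by
  let e₁ : (X × V →₀ 𝕜) →ₗ[𝕜] E := Finsupp.linearCombination 𝕜 fun p => (Λ p.1).adjoint p.2
  let e₂ : (X × V →₀ 𝕜) →ₗ[𝕜] H := Finsupp.linearCombination 𝕜 fun p => RKHS.kerFun H p.1 p.2
  -- A vector orthogonal to every `(Λ x)† v` is annihilated by every `Λ x`.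
  have h₁ : DenseRange e₁ := by
    have : (LinearMap.range e₁).topologicalClosure = ⊤ := by
      refine Submodule.orthogonal_eq_bot_iff.mp ((Submodule.eq_bot_iff _).mpr fun f hf => ?_)
      refine hinj f fun x => ext_inner_left 𝕜 fun v => ?_
      rw [inner_zero_right, ← ContinuousLinearMap.adjoint_inner_left]
      refine hf _ (subset_closure ⟨Finsupp.single (x, v) 1, ?_⟩)
      simp [e₁]
    intro y
    have : y ∈ (LinearMap.range e₁).topologicalClosure := by rw [this]; trivial
    exact this
  have h₂ : DenseRange e₂ := by
    have := RKHS.kerFun_dense (𝕜 := 𝕜) (X := X) (V := V) H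
    have hset : {RKHS.kerFun H x v | (x) (v)} =
        Set.range fun p : X × V => RKHS.kerFun H p.1 p.2 := by
      ext; simp
    rw [hset, ← Finsupp.range_linearCombination 𝕜] at this
    intro y
    have hy : y ∈ (LinearMap.range e₂).topologicalClosure := by rw [this]; trivial
    exact hy
  -- The two spanning families have the same Gram matrix, so matching them is isometric.
  have hinner : ∀ f g, inner 𝕜 (e₁ f) (e₁ g) = inner 𝕜 (e₂ f) (e₂ g) := by
    intro f g
    simp only [e₁, e₂, Finsupp.linearCombination_apply, Finsupp.sum_inner, Finsupp.inner_sum,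
      inner_smul_left, inner_smul_right]
    congr! 5 with p _
    ext r c
    rw [RKHS.kerFun_inner, RKHS.kerFun_apply, hker, ContinuousLinearMap.adjoint_inner_left]
    rfl
  have hnorm : ∀ f, ‖e₂ (LinearEquiv.refl 𝕜 _ f)‖ = ‖e₁ f‖ := by
    intro f
    rw [@norm_eq_sqrt_re_inner 𝕜, @norm_eq_sqrt_re_inner 𝕜, hinner]
    rfl
  let U := (LinearEquiv.refl 𝕜 (X × V →₀ 𝕜)).extendOfIsometry e₁ e₂ h₁ h₂ hnorm
  refine ⟨U, fun e x => ext_inner_left 𝕜 fun v => ?_⟩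
  have hU : U ((Λ x).adjoint v) = RKHS.kerFun H x v := by
    have := (LinearEquiv.refl 𝕜 (X × V →₀ 𝕜)).extendOfIsometry_eq e₁ e₂ h₁ h₂ hnorm
      (Finsupp.single (x, v) 1)
    simpa [e₁, e₂] using this
  rw [← RKHS.kerFun_inner, ← hU, U.inner_map_map, ContinuousLinearMap.adjoint_inner_left]

end Reproducing

/-! ### Square-summable families: density, separability, convergence. -/

section SquareSummable

variable {ι : Type*}

theorem memℓp_two_iff {f : ι → ℂ} : Memℓp f 2 ↔ Summable fun i => ‖f i‖ ^ 2 := by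
  rw [memℓp_gen_iff (by norm_num)]
  simp

theorem hasSum_norm_sq (y : lp (fun _ : ι => ℂ) 2) : HasSum (fun i => ‖y i‖ ^ 2) (‖y‖ ^ 2) := by
  simpa using lp.hasSum_norm (p := 2) (by norm_num) y

theorem norm_apply_le_norm_lp_two (y : lp (fun _ : ι => ℂ) 2) (i : ι) : ‖y i‖ ≤ ‖y‖ :=
  lp.norm_apply_le_norm (by norm_num) y i

theorem norm_le_of_apply_le {σ : ι → ι} (hσ : σ.Injective) {C : ℝ} (hC : 0 ≤ C)
    {x y : lp (fun _ : ι => ℂ) 2} (h : ∀ i, ‖x i‖ ≤ C * ‖y (σ i)‖) : ‖x‖ ≤ C * ‖y‖ := by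
  refine le_of_sq_le_sq ?_ (by positivity)
  rw [mul_pow]
  have h1 : Summable fun i => ‖y (σ i)‖ ^ 2 := (hasSum_norm_sq y).summable.comp_injective hσ
  have h2 : ∑' i, ‖y (σ i)‖ ^ 2 ≤ ‖y‖ ^ 2 :=
    (hasSum_norm_sq y).tsum_eq ▸
      tsum_comp_le_tsum_of_inj (hasSum_norm_sq y).summable (fun _ => by positivity) hσ
  refine (hasSum_le (fun i => ?_) (hasSum_norm_sq x) (h1.hasSum.mul_left (C ^ 2))).trans ?_
  · rw [← mul_pow]; exact pow_le_pow_left₀ (norm_nonneg _) (h i) 2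
  · gcongr

/-- Finitely supported sequences are dense in `ℓ²`. -/
theorem dense_finite_support :
    Dense {y : lp (fun _ : ι => ℂ) 2 | (Function.support fun i => y i).Finite} := by
  classical
  intro y
  refine mem_closure_of_tendsto (lp.hasSum_single (by norm_num) y) (Filter.Eventually.of_forall ?_)
  intro s
  refine s.finite_toSet.subset fun i hi => ?_
  by_contra his
  refine hi ?_
  simp only [lp.coeFn_sum, Finset.sum_apply]
  refine Finset.sum_eq_zero fun j hj => ?_
  rw [lp.single_apply_ne]
  rintro rfl
  exact his hj

theorem secondCountable_lp_two [Countable ι] :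
    SecondCountableTopology (lp (fun _ : ι => ℂ) 2) := by
  classical
  have hsep : TopologicalSpace.IsSeparable
      (closure (Submodule.span ℂ (Set.range fun i : ι => lp.single (E := fun _ => ℂ) 2 i (1 : ℂ)) :
        Set (lp (fun _ : ι => ℂ) 2))) :=
    ((Set.countable_range _).isSeparable.span).closure
  have huniv : TopologicalSpace.IsSeparable (Set.univ : Set (lp (fun _ : ι => ℂ) 2)) := by
    refine hsep.mono fun y _ => ?_
    refine mem_closure_of_tendsto (lp.hasSum_single (by norm_num) y)
      (Filter.Eventually.of_forall fun s => Submodule.sum_mem _ fun i _ => ?_)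
    have : lp.single (E := fun _ : ι => ℂ) 2 i (y i) = y i • lp.single 2 i (1 : ℂ) := by
      rw [← lp.single_smul]; simp
    rw [this]
    exact Submodule.smul_mem _ _ (Submodule.subset_span ⟨i, rfl⟩)
  have := TopologicalSpace.isSeparable_univ_iff.1 huniv
  exact UniformSpace.secondCountable_of_separable _

/-- Dominated convergence in `ℓ²`. -/
theorem tendsto_lp_two_of_dominated {g : ι → ℝ} (hg : Summable fun i => g i ^ 2)
    {y : ℕ → lp (fun _ : ι => ℂ) 2} {v : lp (fun _ : ι => ℂ) 2}
    (hb : ∀ k i, ‖y k i - v i‖ ≤ g i)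
    (hlim : ∀ i, Filter.Tendsto (fun k => y k i) Filter.atTop (𝓝 (v i))) :
    Filter.Tendsto y Filter.atTop (𝓝 v) := by
  rw [tendsto_iff_norm_sub_tendsto_zero]
  have h : Filter.Tendsto (fun k => ∑' i, ‖(y k - v : lp (fun _ : ι => ℂ) 2) i‖ ^ 2) Filter.atTop
      (𝓝 (∑' _ : ι, (0 : ℝ))) := by
    refine tendsto_tsum_of_dominated_convergence hg (fun i => ?_)
      (Filter.Eventually.of_forall fun k i => ?_)
    · have := ((hlim i).sub_const (v i)).norm.pow 2
      simpa using this
    · rw [Real.norm_of_nonneg (by positivity)]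
      exact pow_le_pow_left₀ (norm_nonneg _) (hb k i) 2
  rw [tsum_zero] at h
  simp only [(hasSum_norm_sq _).tsum_eq] at h
  simpa using h.sqrt

end SquareSummable

/-! ### Weighted backward shifts and invertibility of `1 + S`. -/

section Shift

variable {κ : Type*}

theorem exists_weighted_shift (c : ℕ → κ → ℂ) {C : ℝ} (hc : ∀ n q, ‖c n q‖ ≤ C) :
    ∃ S : lp (fun _ : ℕ × κ => ℂ) 2 →L[ℂ] lp (fun _ : ℕ × κ => ℂ) 2,
      ∀ y n q, S y (n, q) = c n q * y (n + 1, q) := by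
  have hinj : Function.Injective fun i : ℕ × κ => (i.1 + 1, i.2) := by
    rintro ⟨n, q⟩ ⟨m, r⟩ h
    simpa using h
  have hle : ∀ (y : lp (fun _ : ℕ × κ => ℂ) 2) (i : ℕ × κ),
      ‖c i.1 i.2 * y (i.1 + 1, i.2)‖ ≤ max C 0 * ‖y (i.1 + 1, i.2)‖ := by
    intro y i
    rw [norm_mul]
    gcongr
    exact (hc _ _).trans (le_max_left _ _)
  have hmem : ∀ y : lp (fun _ : ℕ × κ => ℂ) 2,
      Memℓp (fun i : ℕ × κ => c i.1 i.2 * y (i.1 + 1, i.2)) 2 := by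
    intro y
    rw [memℓp_two_iff]
    refine Summable.of_nonneg_of_le (fun _ => by positivity) (fun i => ?_)
      (((hasSum_norm_sq y).summable.comp_injective hinj).mul_left (max C 0 ^ 2))
    rw [Function.comp_apply, ← mul_pow]
    exact pow_le_pow_left₀ (norm_nonneg _) (hle y i) 2
  let S : lp (fun _ : ℕ × κ => ℂ) 2 →ₗ[ℂ] lp (fun _ : ℕ × κ => ℂ) 2 :=
    { toFun := fun y => ⟨_, hmem y⟩
      map_add' := fun x y => by ext i; exact mul_add _ _ _
      map_smul' := fun t y => by ext i; exact mul_left_comm _ _ _ }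
  exact ⟨S.mkContinuous (max C 0) fun y =>
    norm_le_of_apply_le hinj (le_max_right _ _) (hle y), fun y n q => rfl⟩

theorem shift_pow_apply {c : ℕ → κ → ℂ}
    {S : lp (fun _ : ℕ × κ => ℂ) 2 →L[ℂ] lp (fun _ : ℕ × κ => ℂ) 2}
    (hS : ∀ y n q, S y (n, q) = c n q * y (n + 1, q)) (k : ℕ) (y : lp (fun _ : ℕ × κ => ℂ) 2)
    (n : ℕ) (q : κ) : (S ^ k) y (n, q) = (∏ j ∈ Finset.range k, c (n + j) q) * y (n + k, q) := by
  induction k generalizing y with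
  | zero => simp
  | succ k ih =>
    rw [pow_succ, ContinuousLinearMap.mul_def, ContinuousLinearMap.comp_apply, ih, hS, Finset.prod_range_succ, mul_assoc,
      add_assoc]

/-- If the weights are bounded and eventually at most `r < 1`, then `1 + S` is invertible for the
weighted shift `S`. -/
theorem isUnit_one_add_shift {c : ℕ → κ → ℂ} {C r : ℝ} {N : ℕ} (hr : r < 1)
    (hC : ∀ n q, ‖c n q‖ ≤ C) (hN : ∀ n q, N ≤ n → ‖c n q‖ ≤ r)
    {S : lp (fun _ : ℕ × κ => ℂ) 2 →L[ℂ] lp (fun _ : ℕ × κ => ℂ) 2}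
    (hS : ∀ y n q, S y (n, q) = c n q * y (n + 1, q)) : IsUnit (1 + S) := by
  -- The bound `r` need not be positive; `s` is, so division by it is safe.
  obtain ⟨s, hs0, hs1, hrs⟩ : ∃ s : ℝ, 0 < s ∧ s < 1 ∧ r ≤ s :=
    ⟨max r (1 / 2), by positivity, by simp [hr]; norm_num, le_max_left _ _⟩
  set D := max C s with hD
  have hD1 : 1 ≤ D / s := by rw [one_le_div hs0]; exact le_max_right _ _
  -- Weights at indices below `N` cost `D` instead of `s`. The truncated exponent `N - n` counts
  -- those still ahead of `n`, and keeping this factor on both sides lets the induction close.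
  have hprod : ∀ k n q, (∏ j ∈ Finset.range k, ‖c (n + j) q‖) * (D / s) ^ (N - (n + k)) ≤
      s ^ k * (D / s) ^ (N - n) := by
    intro k n q
    induction k with
    | zero => simp
    | succ k ih =>
      have hstep : ‖c (n + k) q‖ * (D / s) ^ (N - (n + (k + 1))) ≤
          s * (D / s) ^ (N - (n + k)) := by
        by_cases h : N ≤ n + k
        · rw [Nat.sub_eq_zero_of_le h, Nat.sub_eq_zero_of_le (by omega)]
          simpa using (hN _ q h).trans hrs
        · rw [show N - (n + k) = N - (n + (k + 1)) + 1 by omega, pow_succ]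
          calc _ ≤ D * (D / s) ^ (N - (n + (k + 1))) := by
                gcongr; exact (hC _ _).trans (le_max_left _ _)
            _ = _ := by field_simp
      calc _ = (∏ j ∈ Finset.range k, ‖c (n + j) q‖) *
            (‖c (n + k) q‖ * (D / s) ^ (N - (n + (k + 1)))) := by
              rw [Finset.prod_range_succ]; ring
        _ ≤ (∏ j ∈ Finset.range k, ‖c (n + j) q‖) * (s * (D / s) ^ (N - (n + k))) := by
              gcongr
        _ = s * ((∏ j ∈ Finset.range k, ‖c (n + j) q‖) * (D / s) ^ (N - (n + k))) := by ring
        _ ≤ s * (s ^ k * (D / s) ^ (N - n)) := by gcongr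
        _ = _ := by ring
  have hprod' : ∀ k n q, ‖∏ j ∈ Finset.range k, c (n + j) q‖ ≤ s ^ k * (D / s) ^ N := by
    intro k n q
    rw [norm_prod]
    calc _ ≤ (∏ j ∈ Finset.range k, ‖c (n + j) q‖) * (D / s) ^ (N - (n + k)) :=
          le_mul_of_one_le_right (Finset.prod_nonneg fun _ _ => norm_nonneg _)
            (one_le_pow₀ hD1)
      _ ≤ _ := hprod k n q
      _ ≤ _ := by gcongr; exact Nat.sub_le _ _
  have hnorm : ∀ k, ‖S ^ k‖ ≤ s ^ k * (D / s) ^ N := by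
    intro k
    have h0 : 0 ≤ s ^ k * (D / s) ^ N := by positivity
    refine ContinuousLinearMap.opNorm_le_bound _ h0 fun y =>
      norm_le_of_apply_le (σ := fun i => (i.1 + k, i.2)) ?_ h0 fun i => ?_
    · rintro ⟨n, q⟩ ⟨m, r⟩ h
      simpa using h
    · rw [show i = (i.1, i.2) from rfl, shift_pow_apply hS, norm_mul]
      gcongr
      exact hprod' _ _ _
  have hlim : Filter.Tendsto (fun k : ℕ => s ^ k * (D / s) ^ N) Filter.atTop (𝓝 0) := by
    simpa using (tendsto_pow_atTop_nhds_zero_of_lt_one hs0.le hs1).mul_const ((D / s) ^ N)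
  obtain ⟨k, hk⟩ := (hlim.eventually (gt_mem_nhds one_pos)).exists
  have hunit : IsUnit (1 - (-S) ^ k) := by
    refine isUnit_one_sub_of_norm_lt_one ?_
    have : ‖(-S) ^ k‖ = ‖S ^ k‖ := by
      rcases Nat.even_or_odd k with h | h <;> simp [h.neg_pow]
    rw [this]
    exact (hnorm k).trans_lt hk
  -- `1 - (-S)^k` factors as `1 + S` times a geometric sum; the factors commute, so each is a unit.
  rw [← mul_neg_geom_sum] at hunit
  have hcomm : Commute (1 - -S) (∑ i ∈ Finset.range k, (-S) ^ i) :=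
    (Commute.one_left _).sub_left (Commute.sum_right _ _ _ fun i _ => Commute.self_pow _ i)
  simpa using (hcomm.isUnit_mul_iff.1 hunit).1

end Shift

/-! ### Dynamics of the shift with weights `a (n + 1) q / a n q`. -/

section ShiftDynamics

theorem exists_lp_two_of_finite_support {ι : Type*} {f : ι → ℂ} (hf : f.support.Finite) :
    ∃ v : lp (fun _ : ι => ℂ) 2, ∀ i, v i = f i := by
  have h : Memℓp f 2 := by
    rw [memℓp_two_iff]
    refine summable_of_hasFiniteSupport (hf.subset fun i hi => ?_)
    simpa using hi
  exact ⟨⟨f, h⟩, fun i => rfl⟩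

variable {κ : Type*} {a : ℕ → κ → ℂ} (ha : ∀ n q, a n q ≠ 0)
  {S : lp (fun _ : ℕ × κ => ℂ) 2 →L[ℂ] lp (fun _ : ℕ × κ => ℂ) 2}
  (hS : ∀ y n q, S y (n, q) = a (n + 1) q / a n q * y (n + 1, q))

include ha in
-- Forward growth is at most geometric, so a large coefficient forces the preceding ones to be
-- fairly large. The base is at least 1 so that exponents can later be enlarged.
theorem norm_le_pow_mul_norm {W : ℝ} (hW : ∀ n q, ‖a (n + 1) q / a n q‖ ≤ W) (j n : ℕ) (q : κ) :
    ‖a (n + j) q‖ ≤ max W 1 ^ j * ‖a n q‖ := by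
  induction j with
  | zero => simp
  | succ j ih =>
    have h1 : ‖a (n + j + 1) q‖ ≤ max W 1 * ‖a (n + j) q‖ := by
      rw [← div_le_iff₀ (norm_pos_iff.2 (ha _ _)), ← norm_div]
      exact (hW _ _).trans (le_max_left _ _)
    calc _ ≤ max W 1 * ‖a (n + j) q‖ := h1
      _ ≤ max W 1 * (max W 1 ^ j * ‖a n q‖) := by gcongr
      _ = _ := by ring

include ha hS

/-- The product of the weights telescopes. -/
theorem shift_iterate_apply (k : ℕ) (y : lp (fun _ : ℕ × κ => ℂ) 2) (n : ℕ) (q : κ) :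
    (⇑S)^[k] y (n, q) = a (n + k) q / a n q * y (n + k, q) := by
  induction k generalizing y with
  | zero => simp [ha]
  | succ k ih =>
    have := ha (n + k) q
    rw [Function.iterate_succ_apply, ih, hS, ← add_assoc]
    field_simp

/-- If every level `k` had some `q` with `‖a k q‖` below a fixed bound, then some entry of `S^k x`
at level 0 would always be bounded, and the orbit could not approach a vector all of whose level 0
entries are large. -/
theorem iSup_iInf_eq_top_of_isHypercyclic [Finite κ] [Nonempty κ] (h : IsHypercyclic S) :
    (⨆ n, ⨅ q, ‖a n q‖ₑ) = ⊤ := by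
  have := Fintype.ofFinite κ
  by_contra hM
  set M := ⨆ n, ⨅ q, ‖a n q‖ₑ with hMdef
  have hmin : ∀ n, ∃ q, ‖a n q‖ ≤ M.toReal := by
    intro n
    obtain ⟨q, hq⟩ := exists_eq_ciInf_of_finite (f := fun q => ‖a n q‖ₑ)
    refine ⟨q, ?_⟩
    have : ‖a n q‖ₑ ≤ M := hq.trans_le (le_iSup (fun n => ⨅ q, ‖a n q‖ₑ) n)
    simpa using ENNReal.toReal_mono hM this
  obtain ⟨x, hx⟩ := h
  set R := ∑ q, ‖a 0 q‖⁻¹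
  set t : ℝ := M.toReal * R * ‖x‖ + 1
  -- The small row `q` depends on `k`, hence the value `t` in every row; `t` exceeds the bound on
  -- the orbit by 1.
  obtain ⟨v, hv⟩ := exists_lp_two_of_finite_support
    (f := fun i : ℕ × κ => if i.1 = 0 then (t : ℂ) else 0)
    (Set.Finite.subset ((Set.finite_singleton 0).prod Set.finite_univ) fun i hi => by
      simpa using fun h0 : i.1 ≠ 0 => hi (if_neg h0))
  obtain ⟨_, ⟨k, rfl⟩, hk⟩ := hx.exists_dist_lt v one_pos
  obtain ⟨q, hq⟩ := hmin k
  rw [dist_eq_norm] at hk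
  have h1 := (norm_apply_le_norm_lp_two _ ((0 : ℕ), q)).trans_lt hk
  rw [lp.coeFn_sub, Pi.sub_apply, hv, shift_iterate_apply ha hS, zero_add, if_pos rfl] at h1
  have h2 : ‖a k q / a 0 q * x (k, q)‖ ≤ M.toReal * R * ‖x‖ := by
    rw [norm_mul, norm_div, div_eq_mul_inv]
    gcongr
    · exact Finset.single_le_sum (f := fun q => ‖a 0 q‖⁻¹) (fun _ _ => by positivity)
        (Finset.mem_univ q)
    · exact norm_apply_le_norm_lp_two _ _
  have h3 : t = ‖(t : ℂ)‖ := by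
    rw [Complex.norm_real, Real.norm_of_nonneg]
    positivity
  have h4 := norm_sub_norm_le (t : ℂ) (a k q / a 0 q * x (k, q))
  simp only [t] at h1 h3 h4
  linarith

theorem tendsto_norm_of_isMixing (h : IsMixing S) (q : κ) :
    Filter.Tendsto (fun n => ‖a n q‖) Filter.atTop Filter.atTop := by
  classical
  rw [Filter.tendsto_atTop]
  intro M
  have ha0 : 0 < ‖a 0 q‖ := norm_pos_iff.2 (ha 0 q)
  set t : ℝ := |M| / ‖a 0 q‖ + 1
  set v : lp (fun _ : ℕ × κ => ℂ) 2 := lp.single 2 (0, q) (t : ℂ)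
  obtain ⟨N, hN⟩ := h (Metric.ball 0 1) (Metric.ball v 1) Metric.isOpen_ball Metric.isOpen_ball
    ⟨0, by simp⟩ ⟨v, by simp⟩
  filter_upwards [Filter.eventually_ge_atTop N] with n hn
  obtain ⟨_, ⟨x, hx, rfl⟩, hy⟩ := hN n hn
  rw [mem_ball_zero_iff] at hx
  rw [Metric.mem_ball, dist_eq_norm] at hy
  have h1 := (norm_apply_le_norm_lp_two _ ((0 : ℕ), q)).trans_lt hy
  rw [lp.coeFn_sub, Pi.sub_apply, shift_iterate_apply ha hS, zero_add, lp.single_apply_self] at h1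
  have h2 : ‖a n q / a 0 q * x (n, q)‖ ≤ ‖a n q‖ / ‖a 0 q‖ := by
    rw [norm_mul, norm_div]
    exact mul_le_of_le_one_right (by positivity) ((norm_apply_le_norm_lp_two _ _).trans hx.le)
  have h3 : t = ‖(t : ℂ)‖ := by
    rw [Complex.norm_real, Real.norm_of_nonneg]
    positivity
  have h4 := norm_sub_norm_le (t : ℂ) (a n q / a 0 q * x (n, q))
  rw [norm_sub_rev, ← h3] at h4
  have h5 : |M| / ‖a 0 q‖ ≤ ‖a n q‖ / ‖a 0 q‖ := by
    simp only [t] at h1 h4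
    linarith
  exact (le_abs_self M).trans ((div_le_div_iff_of_pos_right ha0).1 h5)

/-- Take `x = u + w`, where `S^k` kills `u` and `w` is the preimage of `v` obtained by moving its
support up by `k`. The norm of `w` involves only the coefficients `a (n + k) q` with `n < N`; asking
for largeness on this window alone serves both mixing and transitivity. -/
theorem exists_near_iterate_eq {u v : lp (fun _ : ℕ × κ => ℂ) 2}
    (hu : (Function.support fun i => u i).Finite) (hv : (Function.support fun i => v i).Finite)
    {ε : ℝ} (hε : 0 < ε) :
    ∃ (N : ℕ) (C : ℝ), ∀ k, N ≤ k → (∀ n < N, ∀ q, C ≤ ‖a (n + k) q‖) →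
      ∃ x ∈ Metric.ball u ε, (⇑S)^[k] x = v := by
  classical
  obtain ⟨N₁, hN₁⟩ := (hu.image Prod.fst).bddAbove
  obtain ⟨N₂, hN₂⟩ := (hv.image Prod.fst).bddAbove
  set s := hv.toFinset
  set D := ∑ i ∈ s, ‖a i.1 i.2 * v i‖
  have hD : 0 ≤ D := Finset.sum_nonneg fun _ _ => norm_nonneg _
  refine ⟨max N₁ N₂ + 1, (D + 1) / ε, fun k hk hC => ?_⟩
  set w : lp (fun _ : ℕ × κ => ℂ) 2 :=
    ∑ i ∈ s, lp.single 2 (i.1 + k, i.2) (a i.1 i.2 * v i / a (i.1 + k) i.2)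
  have hu0 : (⇑S)^[k] u = 0 := by
    ext ⟨n, q⟩
    rw [shift_iterate_apply ha hS]
    by_cases h0 : u (n + k, q) = 0
    · simp [h0]
    · have := hN₁ ⟨(n + k, q), h0, rfl⟩
      simp only at this
      omega
  have hw : (⇑S)^[k] w = v := by
    have hsingle : ∀ i ∈ s, (S ^ k) (lp.single 2 (i.1 + k, i.2)
        (a i.1 i.2 * v i / a (i.1 + k) i.2)) = lp.single 2 i (v i) := by
      rintro ⟨m, r⟩ _
      ext ⟨n, q⟩
      rw [FunLike.coe_pow_eq_iterate, shift_iterate_apply ha hS]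
      by_cases h : (n, q) = (m, r)
      · obtain ⟨rfl, rfl⟩ := Prod.mk.inj h
        have h1 := ha n q
        have h2 := ha (n + k) q
        simp only [lp.single_apply_self]
        field_simp
      · rw [lp.single_apply_ne _ _ _ h, lp.single_apply_ne, mul_zero]
        simpa using h
    rw [← FunLike.coe_pow_eq_iterate, map_sum, Finset.sum_congr rfl hsingle]
    ext i
    simp only [lp.coeFn_sum, Finset.sum_apply, lp.coeFn_single, Finset.sum_pi_single]
    simp only [s, Set.Finite.mem_toFinset, Function.mem_support, ne_eq, ite_not, ite_eq_right_iff]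
    exact fun h => h.symm
  refine ⟨u + w, ?_, ?_⟩
  · rw [mem_ball_iff_norm, add_sub_cancel_left]
    calc ‖w‖ ≤ ∑ i ∈ s, ‖a i.1 i.2 * v i‖ / ((D + 1) / ε) := by
          refine norm_sum_le_of_le _ fun i hi => ?_
          rw [lp.norm_single (by norm_num), norm_div]
          gcongr
          refine hC _ ?_ _
          have := hN₂ ⟨i, by simpa [s] using hi, rfl⟩
          omega
      _ = D / (D + 1) * ε := by rw [← Finset.sum_div]; field_simp; rfl
      _ < 1 * ε := by gcongr; rw [div_lt_one (by positivity)]; linarith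
      _ = ε := one_mul ε
  · rw [iterate_map_add, hu0, hw, zero_add]

theorem isMixing_of_tendsto_norm [Finite κ]
    (h : ∀ q, Filter.Tendsto (fun n => ‖a n q‖) Filter.atTop Filter.atTop) : IsMixing S := by
  intro U V hU hV hUne hVne
  obtain ⟨u, huU, hu⟩ := dense_finite_support.inter_open_nonempty U hU hUne
  obtain ⟨v, hvV, hv⟩ := dense_finite_support.inter_open_nonempty V hV hVne
  obtain ⟨ε, hε, hball⟩ := Metric.isOpen_iff.1 hU u huU
  obtain ⟨N, C, hNC⟩ := exists_near_iterate_eq ha hS hu hv hε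
  obtain ⟨m, hm⟩ := Filter.eventually_atTop.1
    (Filter.eventually_all.2 fun q => (h q).eventually_ge_atTop C)
  refine ⟨max N m, fun k hk => ?_⟩
  obtain ⟨x, hx, hxv⟩ := hNC k (by omega) fun n _ q => hm (n + k) (by omega) q
  exact ⟨v, ⟨x, hball hx, hxv⟩, hvV⟩

theorem isHypercyclic_of_iSup_iInf_eq_top [Finite κ] [Nonempty κ] {W : ℝ}
    (hW : ∀ n q, ‖a (n + 1) q / a n q‖ ≤ W) (h : (⨆ n, ⨅ q, ‖a n q‖ₑ) = ⊤) :
    IsHypercyclic S := by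
  have := secondCountable_lp_two (ι := ℕ × κ)
  refine isHypercyclic_of_transitive fun U V hU hV hUne hVne => ?_
  obtain ⟨u, huU, hu⟩ := dense_finite_support.inter_open_nonempty U hU hUne
  obtain ⟨v, hvV, hv⟩ := dense_finite_support.inter_open_nonempty V hV hVne
  obtain ⟨ε, hε, hball⟩ := Metric.isOpen_iff.1 hU u huU
  obtain ⟨N, C, hNC⟩ := exists_near_iterate_eq ha hS hu hv hε
  set D := max W 1
  have hD1 : 1 ≤ D := le_max_right _ _
  have hgrow := norm_le_pow_mul_norm ha hW
  -- The levels `n + (m - N)` with `n < N` lie at most `N` steps before `m`, so a bound `D ^ N * C`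
  -- at `m` gives `C` on the whole window. Requiring `2 * N ≤ m` ensures `N ≤ m - N`; discarding
  -- finitely many levels keeps the supremum infinite.
  obtain ⟨m, hm, hlarge⟩ : ∃ m, 2 * N ≤ m ∧ ∀ q, D ^ N * C ≤ ‖a m q‖ := by
    by_contra! hcon
    obtain ⟨q₀⟩ := ‹Nonempty κ›
    have hle : (⨆ n, ⨅ q, ‖a n q‖ₑ) ≤
        ENNReal.ofReal (D ^ N * C) + ∑ n ∈ Finset.range (2 * N), ‖a n q₀‖ₑ := by
      refine iSup_le fun n => ?_
      by_cases hn : 2 * N ≤ n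
      · obtain ⟨q, hq⟩ := hcon n hn
        refine (iInf_le _ q).trans (le_add_right ?_)
        rw [← ofReal_norm]
        exact ENNReal.ofReal_le_ofReal hq.le
      · refine (iInf_le _ q₀).trans (le_add_left ?_)
        exact Finset.single_le_sum (f := fun n => ‖a n q₀‖ₑ) (fun _ _ => zero_le)
          (Finset.mem_range.2 (by omega))
    rw [h, top_le_iff] at hle
    exact (ENNReal.add_ne_top.2 ⟨ENNReal.ofReal_ne_top,
      (ENNReal.sum_lt_top.2 fun _ _ => enorm_lt_top).ne⟩) hle
  obtain ⟨x, hx, hxv⟩ := hNC (m - N) (by omega) fun n hn q => by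
    have h1 := hgrow (N - n) (n + (m - N)) q
    rw [show n + (m - N) + (N - n) = m by omega] at h1
    have h2 : D ^ (N - n) * ‖a (n + (m - N)) q‖ ≤ D ^ N * ‖a (n + (m - N)) q‖ := by
      gcongr
      omega
    exact le_of_mul_le_mul_left ((hlarge q).trans (h1.trans h2)) (by positivity)
  exact ⟨m - N, v, ⟨x, hball hx, hxv⟩, hvV⟩

/-- A vector of period `p` with nonzero entry at `(0, q)` has `a y` constant along the multiples of
`p` in row `q`, so square summability of `y` gives that of `1 / a` there. The growth bound then
fills in the other residues. -/
theorem summable_of_dense_periodicPts {W : ℝ} (hW : ∀ n q, ‖a (n + 1) q / a n q‖ ≤ W)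
    (h : Dense (Function.periodicPts ⇑S)) (q : κ) : Summable fun n => (‖a n q‖ ^ 2)⁻¹ := by
  classical
  obtain ⟨y, ⟨p, hp, hy⟩, hyd⟩ := h.exists_dist_lt
    (lp.single (E := fun _ : ℕ × κ => ℂ) 2 (0, q) (1 : ℂ)) one_pos
  have hy0 : y (0, q) ≠ 0 := by
    intro h0
    rw [dist_eq_norm] at hyd
    have := (norm_apply_le_norm_lp_two _ ((0 : ℕ), q)).trans_lt hyd
    rw [lp.coeFn_sub, Pi.sub_apply, lp.single_apply_self, h0] at this
    simp at this
  have hper : ∀ j, a (p * j) q * y (p * j, q) = a 0 q * y (0, q) := by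
    intro j
    have h1 : (⇑S)^[p * j] y = y := (hy.mul_const j).eq
    have h2 := shift_iterate_apply ha hS (p * j) y 0 q
    rw [h1, zero_add] at h2
    have := ha 0 q
    rw [h2]
    field_simp
  have hsub : Summable fun j => (‖a (p * j) q‖ ^ 2)⁻¹ := by
    have hinj : Function.Injective fun j : ℕ => (p * j, q) := fun i j hij => by
      simpa [hp.ne'] using hij
    refine (((hasSum_norm_sq y).summable.comp_injective hinj).mul_left
      ((‖a 0 q * y (0, q)‖ ^ 2)⁻¹)).congr fun j => ?_
    have h1 : ‖a (p * j) q‖ ≠ 0 := norm_ne_zero_iff.2 (ha _ _)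
    have h2 : ‖y (p * j, q)‖ ≠ 0 := by
      rw [norm_ne_zero_iff]
      intro h0
      have := hper j
      rw [h0, mul_zero] at this
      exact mul_ne_zero (ha 0 q) hy0 this.symm
    rw [Function.comp_apply, ← hper j, norm_mul]
    field_simp
  have : NeZero p := ⟨hp.ne'⟩
  set D := max W 1
  have hD1 : 1 ≤ D := le_max_right _ _
  have hgrow := fun j n => norm_le_pow_mul_norm ha hW j n q
  rw [← (Nat.divModEquiv p).symm.summable_iff]
  -- Growth is controlled forwards only, so `p * j + r` is compared with the next multiple `p * (j +
  -- 1)`.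
  have hprod : Summable fun i : ℕ × Fin p => (‖a (p * (i.1 + 1)) q‖ ^ 2)⁻¹ * (D ^ p) ^ 2 :=
    ((summable_nat_add_iff 1).2 hsub).mul_of_nonneg
      (g := fun _ : Fin p => (D ^ p) ^ 2) (Summable.of_finite ..) (fun _ => by positivity)
      (fun _ => by positivity)
  refine Summable.of_nonneg_of_le (fun _ => by rw [Function.comp_apply]; positivity) (fun i => ?_) hprod
  have h0 : 0 < ‖a (p * i.1 + i.2) q‖ := norm_pos_iff.2 (ha _ _)
  have h0' : 0 < ‖a (p * (i.1 + 1)) q‖ := norm_pos_iff.2 (ha _ _)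
  have h1 : ‖a (p * (i.1 + 1)) q‖ ≤ D ^ p * ‖a (p * i.1 + i.2) q‖ := by
    have h2 := hgrow (p - i.2) (p * i.1 + i.2)
    rw [show p * i.1 + i.2 + (p - i.2) = p * (i.1 + 1) by
      have := i.2.2; rw [mul_add]; omega] at h2
    refine h2.trans ?_
    gcongr
    omega
  have h3 : (Nat.divModEquiv p).symm i = p * i.1 + i.2 := by
    simp [Nat.divModEquiv, mul_comm]
  rw [Function.comp_apply, h3, inv_mul_eq_div, inv_le_comm₀ (by positivity) (by positivity),
    inv_div, div_le_iff₀ (by positivity), ← mul_pow]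
  refine pow_le_pow_left₀ h0'.le (h1.trans_eq (mul_comm _ _)) 2

/-- For finitely supported `v`, cut `a v` off at level `p` and repeat it with period `p`; dividing
by `a` gives a periodic vector, dominated by a multiple of `1 / ‖a‖`. As `p` grows it agrees with
`v` on every fixed entry, so dominated convergence applies. -/
theorem dense_periodicPts_of_summable [Finite κ]
    (h : ∀ q, Summable fun n => (‖a n q‖ ^ 2)⁻¹) : Dense (Function.periodicPts ⇑S) := by
  have := Fintype.ofFinite κ
  have hsum : Summable fun i : ℕ × κ => (‖a i.1 i.2‖ ^ 2)⁻¹ := by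
    rw [← (Equiv.prodComm κ ℕ).summable_iff]
    exact (summable_prod_of_nonneg fun _ => by simp only [Pi.zero_apply, Function.comp_apply]; positivity).2 ⟨h, Summable.of_finite ..⟩
  refine Dense.of_closure (dense_finite_support.mono fun v hv => ?_)
  obtain ⟨C, hC0, hC⟩ : ∃ C, 0 ≤ C ∧ ∀ i : ℕ × κ, ‖a i.1 i.2 * v i‖ ≤ C := by
    refine ⟨∑ i ∈ hv.toFinset, ‖a i.1 i.2 * v i‖, by positivity, fun i => ?_⟩
    by_cases hi : v i = 0
    · rw [hi, mul_zero, norm_zero]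
      positivity
    · exact Finset.single_le_sum (f := fun i : ℕ × κ => ‖a i.1 i.2 * v i‖)
        (fun _ _ => by positivity) (by simpa using hi)
  have hb : ∀ (p n : ℕ) (q : κ), ‖a (n % p) q / a n q * v (n % p, q)‖ ≤ C * ‖a n q‖⁻¹ := by
    intro p n q
    rw [div_mul_eq_mul_div, norm_div, div_eq_mul_inv]
    gcongr
    exact hC (n % p, q)
  have hex : ∀ k : ℕ, ∃ y : lp (fun _ : ℕ × κ => ℂ) 2, ∀ n q,
      y (n, q) = a (n % (k + 1)) q / a n q * v (n % (k + 1), q) := by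
    intro k
    suffices hmem : Memℓp (fun i : ℕ × κ =>
        a (i.1 % (k + 1)) i.2 / a i.1 i.2 * v (i.1 % (k + 1), i.2)) 2 from
      ⟨⟨_, hmem⟩, fun _ _ => rfl⟩
    rw [memℓp_two_iff]
    refine Summable.of_nonneg_of_le (fun _ => by positivity) (fun i => ?_) (hsum.mul_left (C ^ 2))
    rw [← inv_pow, ← mul_pow]
    exact pow_le_pow_left₀ (norm_nonneg _) (hb (k + 1) i.1 i.2) 2
  choose y hy using hex
  have hlim : Filter.Tendsto y Filter.atTop (𝓝 v) := by
    refine tendsto_lp_two_of_dominated (g := fun i => 2 * C * ‖a i.1 i.2‖⁻¹) ?_ ?_ ?_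
    · exact (hsum.mul_left ((2 * C) ^ 2)).congr fun i => by rw [mul_pow (2 * C), inv_pow]
    · rintro k ⟨n, q⟩
      have h1 := hb (k + 1) n q
      have h2 : ‖v (n, q)‖ ≤ C * ‖a n q‖⁻¹ := by
        have := hC (n, q)
        rw [norm_mul, mul_comm] at this
        rwa [← div_eq_mul_inv, le_div_iff₀ (norm_pos_iff.2 (ha n q))]
      calc _ ≤ ‖y k (n, q)‖ + ‖v (n, q)‖ := norm_sub_le _ _
        _ ≤ C * ‖a n q‖⁻¹ + C * ‖a n q‖⁻¹ := add_le_add (by rwa [hy]) h2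
        _ = _ := by ring
    · rintro ⟨n, q⟩
      refine tendsto_const_nhds.congr' ?_
      filter_upwards [Filter.eventually_ge_atTop n] with k hk
      rw [hy, Nat.mod_eq_of_lt (by omega), div_self (ha n q), one_mul]
  refine mem_closure_of_tendsto hlim (Filter.Eventually.of_forall fun k => ⟨k + 1, by omega, ?_⟩)
  change (⇑S)^[k + 1] (y k) = y k
  ext ⟨n, q⟩
  have h1 := ha (n + (k + 1)) q
  rw [shift_iterate_apply ha hS, hy, hy, Nat.add_mod_right]
  field_simp

theorem isHypercyclic_shift_iff [Finite κ] [Nonempty κ] {W : ℝ}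
    (hW : ∀ n q, ‖a (n + 1) q / a n q‖ ≤ W) :
    IsHypercyclic S ↔ (⨆ n, ⨅ q, ‖a n q‖ₑ) = ⊤ :=
  ⟨iSup_iInf_eq_top_of_isHypercyclic ha hS, isHypercyclic_of_iSup_iInf_eq_top ha hS hW⟩

theorem isMixing_shift_iff [Finite κ] :
    IsMixing S ↔ ∀ q, Filter.Tendsto (fun n => ‖a n q‖) Filter.atTop Filter.atTop :=
  ⟨tendsto_norm_of_isMixing ha hS, isMixing_of_tendsto_norm ha hS⟩

theorem isChaotic_shift_iff [Finite κ] [Nonempty κ] {W : ℝ}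
    (hW : ∀ n q, ‖a (n + 1) q / a n q‖ ≤ W) :
    IsChaotic S ↔ ∀ q, Summable fun n => (‖a n q‖ ^ 2)⁻¹ := by
  refine ⟨fun h => summable_of_dense_periodicPts ha hS hW h.2, fun h =>
    ⟨?_, dense_periodicPts_of_summable ha hS h⟩⟩
  have := secondCountable_lp_two (ι := ℕ × κ)
  have htend : ∀ q, Filter.Tendsto (fun n => ‖a n q‖) Filter.atTop Filter.atTop := by
    intro q
    have h1 : Filter.Tendsto (fun n => ‖a n q‖ ^ 2) Filter.atTop Filter.atTop := by
      have := (h q).tendsto_atTop_zero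
      refine tendsto_inv_nhdsGT_zero.comp
        (tendsto_nhdsWithin_iff.2 ⟨this, Filter.Eventually.of_forall fun n => ?_⟩)|>.congr ?_
      · have := norm_pos_iff.2 (ha n q)
        simp only [Set.mem_Ioi]
        positivity
      · intro n; simp
    refine (Real.tendsto_sqrt_atTop.comp h1).congr fun n => ?_
    rw [Function.comp_apply, Real.sqrt_sq (norm_nonneg _)]
  refine isHypercyclic_of_transitive fun U V hU hV hUne hVne => ?_
  obtain ⟨N, hN⟩ := isMixing_of_tendsto_norm ha hS htend U V hU hV hUne hVne
  exact ⟨N, hN N le_rfl⟩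

end ShiftDynamics

/-! ### Uniform bounds over the finitely many rows, and uniqueness of coefficients. -/

theorem exists_forall_le_of_bddAbove {κ : Type*} [Finite κ] {f : ℕ → κ → ℝ}
    (h : ∀ q, BddAbove (Set.range fun n => f n q)) : ∃ C, ∀ n q, f n q ≤ C := by
  choose C hC using h
  obtain ⟨D, hD⟩ := (Set.finite_range C).bddAbove
  exact ⟨D, fun n q => (hC q ⟨n, rfl⟩).trans (hD ⟨q, rfl⟩)⟩

theorem exists_lt_one_of_limsup_enorm_lt_one {κ : Type*} [Finite κ] {c : ℕ → κ → ℂ}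
    (h : ∀ q, Filter.limsup (fun n => ‖c n q‖ₑ) Filter.atTop < 1) :
    ∃ r < (1 : ℝ), ∃ N, ∀ n q, N ≤ n → ‖c n q‖ ≤ r := by
  have := Fintype.ofFinite κ
  have hsup : (Finset.univ.sup fun q => Filter.limsup (fun n => ‖c n q‖ₑ) Filter.atTop) < 1 :=
    (Finset.sup_lt_iff one_pos).2 fun q _ => h q
  obtain ⟨r, hr, hr1⟩ := exists_between hsup
  have hev : ∀ᶠ n in Filter.atTop, ∀ q, ‖c n q‖ₑ < r := Filter.eventually_all.2 fun q =>
    Filter.eventually_lt_of_limsup_lt ((Finset.le_sup (f := fun q =>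
      Filter.limsup (fun n => ‖c n q‖ₑ) Filter.atTop) (Finset.mem_univ q)).trans_lt hr)
  obtain ⟨N, hN⟩ := Filter.eventually_atTop.1 hev
  have hrtop : r ≠ ⊤ := (hr1.trans ENNReal.one_lt_top).ne
  refine ⟨r.toReal, by simpa using (ENNReal.toReal_lt_toReal hrtop ENNReal.one_ne_top).2 hr1, N,
    fun n q hn => ?_⟩
  simpa using ENNReal.toReal_mono hrtop (hN n hn q).le

theorem eq_zero_of_hasSum_pow_mul_zero {c : ℕ → ℂ}
    (h : ∀ z : 𝔻, HasSum (fun n => (z : ℂ) ^ n * c n) 0) (n : ℕ) : c n = 0 := by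
  let p : FormalMultilinearSeries ℂ ℂ ℂ := fun n => ContinuousMultilinearMap.mkPiRing ℂ (Fin n) (c n)
  have hc : ∀ n, p.coeff n = c n := fun n => by
    simp [p, FormalMultilinearSeries.coeff, ContinuousMultilinearMap.mkPiRing_apply]
  have hp : HasFPowerSeriesAt (0 : ℂ → ℂ) p 0 := by
    rw [hasFPowerSeriesAt_iff]
    filter_upwards [Metric.ball_mem_nhds (0 : ℂ) one_pos] with z hz
    have := h (Complex.UnitDisc.mk z (by simpa using hz))
    simpa [hc] using this
  rw [← hc, hp.eq_zero]
  rfl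

/-! ### Vectors supported in a single row. -/

section Row

variable {d : ℕ}

theorem exists_row {f : ℕ → ℂ} (hf : Summable fun n => ‖f n‖ ^ 2) (q : Fin d) :
    ∃ u : lp (fun _ : ℕ × Fin d => ℂ) 2, ∀ n r, u (n, r) = if r = q then f n else 0 := by
  have hinj : Function.Injective fun n : ℕ => (n, q) := fun i j hij => by simpa using hij
  suffices h : Memℓp (fun i : ℕ × Fin d => if i.2 = q then f i.1 else 0) 2 from
    ⟨⟨_, h⟩, fun _ _ => rfl⟩
  rw [memℓp_two_iff, ← hinj.summable_iff]
  · simpa [Function.comp_def] using hf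
  · rintro ⟨n, r⟩ h
    have : r ≠ q := by rintro rfl; exact h ⟨n, rfl⟩
    simp [this]

theorem hasSum_inner_row {f : ℕ → ℂ} {q : Fin d} {u : lp (fun _ : ℕ × Fin d => ℂ) 2}
    (hu : ∀ n r, u (n, r) = if r = q then f n else 0) (y : lp (fun _ : ℕ × Fin d => ℂ) 2) :
    HasSum (fun n => conj (f n) * y (n, q)) (inner ℂ u y) := by
  have hinj : Function.Injective fun n : ℕ => (n, q) := fun i j hij => by simpa using hij
  have h := lp.hasSum_inner (𝕜 := ℂ) u y
  rw [← hinj.hasSum_iff] at h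
  · simpa [Function.comp_def, hu, mul_comm] using h
  · rintro ⟨n, r⟩ h
    have : r ≠ q := by rintro rfl; exact h ⟨n, rfl⟩
    simp [hu, this]

/-- The vector of inner products with a finite family. -/
noncomputable def innerFamily {E : Type*} [NormedAddCommGroup E] [InnerProductSpace ℂ E] (k : Fin d → E) :
    E →L[ℂ] EuclideanSpace ℂ (Fin d) :=
  (EuclideanSpace.equiv (Fin d) ℂ).symm.toContinuousLinearMap ∘L
    ContinuousLinearMap.pi fun q => innerSL ℂ (k q)

@[simp]
theorem innerFamily_apply {E : Type*} [NormedAddCommGroup E] [InnerProductSpace ℂ E]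
    (k : Fin d → E) (x : E) (q : Fin d) : innerFamily k x q = inner ℂ (k q) x := rfl

theorem adjoint_innerFamily {E : Type*} [NormedAddCommGroup E] [InnerProductSpace ℂ E]
    [CompleteSpace E] (k : Fin d → E) (v : EuclideanSpace ℂ (Fin d)) :
    (innerFamily k).adjoint v = ∑ q, v q • k q := by
  refine ext_inner_right ℂ fun x => ?_
  simp [ContinuousLinearMap.adjoint_inner_left, PiLp.inner_apply, sum_inner, inner_smul_left,
    mul_comm]

end Row

/-! ### The coefficient model of the space `H`. -/

section Model

variable {d : ℕ} {A B : ℕ → Matrix (Fin d) (Fin d) ℂ} {Q : Matrix (Fin d) (Fin d) ℂ}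
  {a b : ℕ → Fin d → ℂ}

theorem kernelTerm_eq_conj_diagonal (hQ : Q ∈ Matrix.unitaryGroup (Fin d) ℂ)
    (hA : ∀ n, A n = Qᴴ * Matrix.diagonal (a n) * Q)
    (hB : ∀ n, B n = Qᴴ * Matrix.diagonal (b n) * Q) (z w : 𝔻) (n : ℕ) :
    kernelTerm A B z w n = Qᴴ * Matrix.diagonal (fun q => ((z : ℂ) ^ n * (a n q + z * b n q)) *
      conj ((w : ℂ) ^ n * (a n q + w * b n q))) * Q := by
  have hQ1 : Q * Qᴴ = 1 := Matrix.mem_unitaryGroup_iff.1 hQ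
  have h1 : ∀ z : ℂ, A n + z • B n = Qᴴ * Matrix.diagonal (a n + z • b n) * Q := by
    intro z
    have hdiag : Matrix.diagonal (a n + z • b n) =
        Matrix.diagonal (a n) + z • Matrix.diagonal (b n) := by
      rw [← Matrix.diagonal_smul]
      exact (Matrix.diagonal_add _ _).symm
    rw [hA, hB, hdiag]
    simp only [Matrix.mul_add, Matrix.add_mul, Matrix.mul_smul, Matrix.smul_mul]
  have h2 : (A n)ᴴ + conj (w : ℂ) • (B n)ᴴ = (A n + (w : ℂ) • B n)ᴴ := by
    simp [Matrix.conjTranspose_smul]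
  have h3 : ∀ D D' : Matrix (Fin d) (Fin d) ℂ,
      (Qᴴ * D * Q) * (Qᴴ * D' * Q) = Qᴴ * (D * D') * Q := by
    intro D D'
    calc _ = Qᴴ * D * (Q * Qᴴ) * D' * Q := by simp only [Matrix.mul_assoc]
      _ = _ := by rw [hQ1]; simp only [Matrix.mul_assoc, Matrix.one_mul]
  have h4 : (Qᴴ * Matrix.diagonal (a n + (w : ℂ) • b n) * Q)ᴴ =
      Qᴴ * Matrix.diagonal (star (a n + (w : ℂ) • b n)) * Q := by
    simp [Matrix.conjTranspose_mul, Matrix.mul_assoc, Matrix.diagonal_conjTranspose]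
  rw [kernelTerm, h2, h1, h1, h4, h3, Matrix.diagonal_mul_diagonal, ← Matrix.smul_mul,
    ← Matrix.mul_smul, ← Matrix.diagonal_smul]
  congr 3
  ext q
  simp
  ring

/-- Convergence of the kernel on the diagonal controls only `a + z b`. Adding the series at `z` and
`-z` separates `a` from `b` by the parallelogram law. -/
theorem summable_norm_sq_pow_mul (hQ : Q ∈ Matrix.unitaryGroup (Fin d) ℂ)
    (hA : ∀ n, A n = Qᴴ * Matrix.diagonal (a n) * Q)
    (hB : ∀ n, B n = Qᴴ * Matrix.diagonal (b n) * Q)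
    (hconv : ∀ z w : 𝔻, Summable (kernelTerm A B z w)) (z : 𝔻) (q : Fin d) :
    Summable fun n => ‖(z : ℂ) ^ n * a n q‖ ^ 2 := by
  have hQ1 : Q * Qᴴ = 1 := Matrix.mem_unitaryGroup_iff.1 hQ
  have key : ∀ z : 𝔻, Summable fun n => ‖(z : ℂ) ^ n * (a n q + z * b n q)‖ ^ 2 := by
    intro z
    have h1 := ((hconv z z).mul_left Q).mul_right Qᴴ
    have h2 : Summable fun n => (Q * kernelTerm A B z z n * Qᴴ) q q :=
      Pi.summable.1 (Pi.summable.1 h1 q) q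
    refine Complex.summable_ofReal.1 (h2.congr fun n => ?_)
    have h3 : ∀ D : Matrix (Fin d) (Fin d) ℂ, Q * (Qᴴ * D * Q) * Qᴴ = D := by
      intro D
      calc _ = (Q * Qᴴ) * D * (Q * Qᴴ) := by simp only [Matrix.mul_assoc]
        _ = D := by rw [hQ1, Matrix.one_mul, Matrix.mul_one]
    rw [kernelTerm_eq_conj_diagonal hQ hA hB, h3, Matrix.diagonal_apply_eq, Complex.mul_conj,
      Complex.normSq_eq_norm_sq]
  refine Summable.of_nonneg_of_le (fun _ => by positivity) (fun n => ?_) ((key z).add (key (-z)))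
  have h1 : ‖((-z : 𝔻) : ℂ) ^ n * (a n q + (-z : 𝔻) * b n q)‖ =
      ‖(z : ℂ) ^ n * (a n q - z * b n q)‖ := by
    simp [← sub_eq_add_neg]
  have h2 := parallelogram_law_with_norm ℂ ((z : ℂ) ^ n * a n q) ((z : ℂ) ^ n * (z * b n q))
  rw [← mul_add, ← mul_sub] at h2
  rw [h1]
  nlinarith [sq_nonneg ‖(z : ℂ) ^ n * a n q‖, sq_nonneg ‖(z : ℂ) ^ n * (z * b n q)‖]

theorem exists_coefficient_model (hQ : Q ∈ Matrix.unitaryGroup (Fin d) ℂ)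
    (hA : ∀ n, A n = Qᴴ * Matrix.diagonal (a n) * Q)
    (hB : ∀ n, B n = Qᴴ * Matrix.diagonal (b n) * Q)
    (hconv : ∀ z w : 𝔻, Summable (kernelTerm A B z w)) (ha : ∀ n q, a n q ≠ 0)
    {V : lp (fun _ : ℕ × Fin d => ℂ) 2 →L[ℂ] lp (fun _ : ℕ × Fin d => ℂ) 2}
    (hV : ∀ y n q, V y (n, q) = conj (b n q / a (n + 1) q) * y (n + 1, q))
    (hunit : IsUnit (1 + V))
    {H : Type*} [NormedAddCommGroup H] [InnerProductSpace ℂ H] [CompleteSpace H]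
    [RKHS ℂ H 𝔻 (EuclideanSpace ℂ (Fin d))] (hH : RKHS.kernel H = tridiagonalKernel A B) :
    ∃ Φ : lp (fun _ : ℕ × Fin d => ℂ) 2 ≃L[ℂ] H, ∀ y (z : 𝔻),
      HasSum (fun n => (z : ℂ) ^ n • Matrix.toEuclideanCLM (n := Fin d) (𝕜 := ℂ) Qᴴ
        (WithLp.toLp 2 fun q => a n q * y (n, q))) (Φ y z) := by
  have hm : ∀ (z : 𝔻) (q : Fin d), ∃ u : lp (fun _ : ℕ × Fin d => ℂ) 2, ∀ n r,
      u (n, r) = if r = q then conj ((z : ℂ) ^ n * a n q) else 0 := fun z q =>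
    exists_row (by simpa using summable_norm_sq_pow_mul hQ hA hB hconv z q) q
  choose m hm using hm
  obtain ⟨k, hkm⟩ : ∃ k : 𝔻 → Fin d → lp (fun _ : ℕ × Fin d => ℂ) 2,
      ∀ z q, k z q = (1 + V) (m z q) := ⟨_, fun _ _ => rfl⟩
  have hk : ∀ (z : 𝔻) (q : Fin d) n r, k z q (n, r) =
      if r = q then conj ((z : ℂ) ^ n * (a n q + z * b n q)) else 0 := by
    intro z q n r
    have h0 : k z q (n, r) = m z q (n, r) + V (m z q) (n, r) := by rw [hkm]; rfl
    rw [h0, hV, hm, hm]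
    split_ifs with h
    · subst h
      rw [← map_mul, ← map_add]
      have := ha (n + 1) r
      congr 1
      field_simp
      ring
    · simp
  let Λ : 𝔻 → lp (fun _ : ℕ × Fin d => ℂ) 2 →L[ℂ] EuclideanSpace ℂ (Fin d) := fun z =>
    Matrix.toEuclideanCLM (n := Fin d) (𝕜 := ℂ) Qᴴ ∘L innerFamily (k z)
  have hker : ∀ z w, RKHS.kernel H z w = Λ z ∘L (Λ w).adjoint := by
    intro z w
    set s : Fin d → ℂ := fun q => inner ℂ (k z q) (k w q)
    have hs : HasSum (kernelTerm A B z w) (Qᴴ * Matrix.diagonal s * Q) := by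
      simp only [funext (kernelTerm_eq_conj_diagonal hQ hA hB z w)]
      refine (HasSum.matrix_diagonal (Pi.hasSum.2 fun q => ?_)).mul_left Qᴴ |>.mul_right Q
      have := hasSum_inner_row (hk z q) (k w q)
      simpa [hk] using this
    -- Different rows are orthogonal, so the Gram matrix is diagonal.
    have hdiag : innerFamily (k z) ∘L (innerFamily (k w)).adjoint =
        Matrix.toEuclideanCLM (n := Fin d) (𝕜 := ℂ) (Matrix.diagonal s) := by
      ext v q
      have horth : ∀ r, r ≠ q → inner ℂ (k z q) (k w r) = 0 := by
        intro r hr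
        refine (hasSum_inner_row (hk z q) (k w r)).unique ?_
        simp only [hk, if_neg hr.symm, mul_zero]
        exact hasSum_zero
      rw [ContinuousLinearMap.comp_apply, adjoint_innerFamily, innerFamily_apply, inner_sum,
        Finset.sum_eq_single q]
      · simp [s, inner_smul_right, Matrix.ofLp_toEuclideanCLM, Matrix.mulVec_diagonal, mul_comm]
      · intro r _ hr
        rw [inner_smul_right, horth r hr, mul_zero]
      · simp
    have hadj : (Matrix.toEuclideanCLM (n := Fin d) (𝕜 := ℂ) Qᴴ).adjoint =
        Matrix.toEuclideanCLM (n := Fin d) (𝕜 := ℂ) Q := by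
      rw [← ContinuousLinearMap.star_eq_adjoint, ← map_star, Matrix.star_eq_conjTranspose,
        Matrix.conjTranspose_conjTranspose]
    rw [hH, tridiagonalKernel, Matrix.of_apply, hs.tsum_eq, map_mul, map_mul, ← hdiag,
      ContinuousLinearMap.adjoint_comp, hadj]
    rfl
  have hsum : ∀ (y : lp (fun _ : ℕ × Fin d => ℂ) 2) (z : 𝔻) (q : Fin d),
      HasSum (fun n => (z : ℂ) ^ n * (a n q * y (n, q))) (inner ℂ (m z q) y) := by
    intro y z q
    simpa [mul_assoc] using hasSum_inner_row (hm z q) y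
  obtain ⟨u, hu⟩ := hunit.star
  -- `L` is the adjoint of `1 + V`; it trades the vectors `k z q` for the simpler `m z q`.
  let L := ContinuousLinearEquiv.ofUnit u
  have hL : ∀ x y, inner ℂ ((1 + V) x) y = inner ℂ x (L y) := by
    intro x y
    have : L y = star (1 + V) y := by rw [← hu]; rfl
    rw [this, ContinuousLinearMap.star_eq_adjoint, ContinuousLinearMap.adjoint_inner_right]
  have hQinj : Function.Injective (Matrix.toEuclideanCLM (n := Fin d) (𝕜 := ℂ) Qᴴ) := by
    refine Function.LeftInverse.injective
      (g := Matrix.toEuclideanCLM (n := Fin d) (𝕜 := ℂ) Q) fun v => ?_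
    have hQ1 : Q * Qᴴ = 1 := Matrix.mem_unitaryGroup_iff.1 hQ
    rw [← ContinuousLinearMap.comp_apply, ← ContinuousLinearMap.mul_def, ← map_mul, hQ1, map_one]
    rfl
  have hinj : ∀ x, (∀ z, Λ z x = 0) → x = 0 := by
    intro x hx
    have hz : ∀ z q, inner ℂ (m z q) (L x) = 0 := by
      intro z q
      have h1 : innerFamily (k z) x = 0 := hQinj ((hx z).trans (map_zero _).symm)
      rw [← hL, ← hkm, ← innerFamily_apply, h1]
      rfl
    -- The inner products with `m z q` form a power series in `z` with coefficients `a n q * L x (n,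
    -- q)`.
    have hLx : L x = 0 := by
      ext ⟨n, q⟩
      have h1 := eq_zero_of_hasSum_pow_mul_zero (c := fun n => a n q * L x (n, q))
        (fun z => hz z q ▸ hsum (L x) z q) n
      exact (mul_eq_zero.1 h1).resolve_left (ha n q)
    simpa using hLx
  obtain ⟨U, hU⟩ := exists_unitary_of_kernel_eq Λ hker hinj
  refine ⟨L.symm.trans U.toContinuousLinearEquiv, fun y z => ?_⟩
  have h1 : (L.symm.trans U.toContinuousLinearEquiv) y z =
      Matrix.toEuclideanCLM (n := Fin d) (𝕜 := ℂ) Qᴴ (innerFamily (m z) y) := by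
    have h2 : innerFamily (k z) (L.symm y) = innerFamily (m z) y := by
      ext q
      rw [innerFamily_apply, innerFamily_apply, hkm, hL, L.apply_symm_apply]
    rw [← h2]
    exact hU (L.symm y) z
  rw [h1]
  have h3 : HasSum (fun n => (z : ℂ) ^ n • (WithLp.toLp 2 fun q => a n q * y (n, q) :
      EuclideanSpace ℂ (Fin d))) (innerFamily (m z) y) :=
    (Pi.hasSum.2 fun q => hsum y z q).mapL
      (EuclideanSpace.equiv (Fin d) ℂ).symm.toContinuousLinearMap
  simpa using h3.mapL (Matrix.toEuclideanCLM (n := Fin d) (𝕜 := ℂ) Qᴴ)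

theorem diagonal_entry_ne_zero {D : Fin d → ℂ} {M : Matrix (Fin d) (Fin d) ℂ} (hM : IsUnit M)
    (h : M = Qᴴ * Matrix.diagonal D * Q) (q : Fin d) : D q ≠ 0 := by
  have hdet := (Matrix.isUnit_iff_isUnit_det _).1 hM
  rw [h, Matrix.det_mul, Matrix.det_mul, Matrix.det_diagonal] at hdet
  have := hdet.ne_zero
  exact Finset.prod_ne_zero_iff.1 (right_ne_zero_of_mul (left_ne_zero_of_mul this)) q
    (Finset.mem_univ q)

end Model

end TridiagonalShift

theorem theorem5p2 {d : ℕ} (hd : 1 ≤ d)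
    (A B : ℕ → Matrix (Fin d) (Fin d) ℂ)
    (hconv : ∀ z w : 𝔻, Summable (TridiagonalShift.kernelTerm A B z w))
    (hAinv : ∀ n, IsUnit (A n)) (hBinv : ∀ n, IsUnit (B n))
    (Q : Matrix (Fin d) (Fin d) ℂ) (hQ : Q ∈ Matrix.unitaryGroup (Fin d) ℂ)
    (a b : ℕ → Fin d → ℂ)
    (hA : ∀ n, A n = Qᴴ * Matrix.diagonal (a n) * Q)
    (hB : ∀ n, B n = Qᴴ * Matrix.diagonal (b n) * Q)
    (hratio : ∀ q, BddAbove (Set.range fun n => ‖a (n + 1) q / a n q‖))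
    (hlimsup : ∀ q, Filter.limsup (fun n => ‖b n q / a (n + 1) q‖ₑ) Filter.atTop < 1)
    {H : Type*} [NormedAddCommGroup H] [InnerProductSpace ℂ H] [CompleteSpace H]
    [RKHS ℂ H 𝔻 (EuclideanSpace ℂ (Fin d))]
    (hH : RKHS.kernel H = TridiagonalShift.tridiagonalKernel A B) :
    ∃ T : H →L[ℂ] H, TridiagonalShift.IsBackwardShift T ∧
      (TridiagonalShift.IsHypercyclic T ↔ (⨆ n, ⨅ q, ‖a n q‖ₑ) = ⊤) ∧
      (TridiagonalShift.IsMixing T ↔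
        ∀ q, Filter.Tendsto (fun n => ‖a n q‖) Filter.atTop Filter.atTop) ∧
      (TridiagonalShift.IsChaotic T ↔ ∀ q, Summable fun n => (‖a n q‖ ^ 2)⁻¹) := by
  open TridiagonalShift in
  have : Nonempty (Fin d) := ⟨⟨0, hd⟩⟩
  have ha : ∀ n q, a n q ≠ 0 := fun n => diagonal_entry_ne_zero (hAinv n) (hA n)
  obtain ⟨W, hW⟩ := exists_forall_le_of_bddAbove hratio
  obtain ⟨r, hr, N, hN⟩ := exists_lt_one_of_limsup_enorm_lt_one hlimsup
  -- The limsup bound holds only from `N` on; the finitely many earlier ratios merely enlarge `C`.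
  obtain ⟨C, hC⟩ := exists_forall_le_of_bddAbove (f := fun n q => ‖b n q / a (n + 1) q‖) fun q =>
    Filter.IsBoundedUnder.bddAbove_range (Filter.isBoundedUnder_of_eventually_le
      (Filter.eventually_atTop.2 ⟨N, fun n hn => hN n q hn⟩))
  obtain ⟨V, hV⟩ := exists_weighted_shift (fun n q => conj (b n q / a (n + 1) q)) (C := C)
    fun n q => (RCLike.norm_conj _).trans_le (hC n q)
  have hunit : IsUnit (1 + V) := isUnit_one_add_shift hr
    (fun n q => (RCLike.norm_conj _).trans_le (hC n q))
    (fun n q hn => (RCLike.norm_conj _).trans_le (hN n q hn)) hV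
  obtain ⟨Φ, hΦ⟩ := exists_coefficient_model hQ hA hB hconv ha hV hunit hH
  obtain ⟨S, hS⟩ := exists_weighted_shift (fun n q => a (n + 1) q / a n q) hW
  let T : H →L[ℂ] H := Φ.toContinuousLinearMap ∘L S ∘L Φ.symm.toContinuousLinearMap
  have hT : ∀ f, T f = Φ (S (Φ.symm f)) := fun _ => rfl
  have hconj : Function.Semiconj Φ S T := fun y => by rw [hT, Φ.symm_apply_apply]
  have hconj' : Function.Semiconj Φ.symm T S := fun f => by rw [hT, Φ.symm_apply_apply]
  refine ⟨T, fun f => ⟨fun n => Matrix.toEuclideanCLM (n := Fin d) (𝕜 := ℂ) Qᴴ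
    (WithLp.toLp 2 fun q => a n q * Φ.symm f (n, q)), fun z => ?_, fun z => ?_⟩, ?_, ?_, ?_⟩
  · simpa using hΦ (Φ.symm f) z
  · have h := hΦ (S (Φ.symm f)) z
    rw [← hT] at h
    -- The weight of `S` turns `a n q` times the shifted entry into `a (n + 1) q * y (n + 1, q)`,
    -- the next coefficient.
    convert h using 5 with n
    ext q
    have := ha n q
    simp only [hS]
    field_simp
  · rw [← isHypercyclic_shift_iff ha hS hW]
    exact ⟨IsHypercyclic.of_semiconj Φ.symm hconj', IsHypercyclic.of_semiconj Φ hconj⟩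
  · rw [← isMixing_shift_iff ha hS]
    exact ⟨IsMixing.of_semiconj Φ.symm hconj', IsMixing.of_semiconj Φ hconj⟩
  · rw [← isChaotic_shift_iff ha hS hW]
    exact ⟨IsChaotic.of_semiconj Φ.symm hconj', IsChaotic.of_semiconj Φ hconj⟩
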